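/- Call a point $p$ of the Euclidean plane, relative to a continuous map $\varphi:\mathbb{R}^2\to\mathbb{R}^2$, - an *unfolded point* if $\varphi$ preserves distances on some neighborhood of $p$; - a *crease point* if it is not an unfolded point and it has a neighborhood covered by two sets, each containing $p$, on which $\varphi$ agrees respectively with two different isometries of the plane; - a *vertex point* if it is neither an unfolded point nor a crease point and it has a neighborhood covered by finitely many sets, each containing $p$, on each of which $\varphi$ agrees with an isometry of the plane, with at least three distinct isometries occurring. A continuous map $\varphi:\mathbb{R}^2\to\mathbb{R}^2$ is a *local flat folding* if every point of the plane is an unfolded, crease or vertex point and there is at least one vertex point (there may be infinitely many). The *graph* of a local flat folding $\varphi$ is the multigraph $G$ whose vertices are the vertex points of $\varphi$ and, if there is an infinite ray of crease points, one further special vertex $\infty$. Two distinct vertex points are joined by one edge when the open line segment between them consists only of crease points, and each ray with apex a vertex point $p$ that consists, apart from $p$, only of crease points gives an edge between $p$ and $\infty$. A vertex of a graph is an *articulation vertex* if its removal leaves a disconnected graph. **Lemma.** Let $G$ (finite or infinite) be the graph of a local flat folding. Then the special vertex $\infty$ is not an articulation vertex of $G$. That is, if $\infty$ is a vertex of $G$,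 then $G-\infty$ is connected. -/

import Mathlib

namespace FlatFolding

/-- The Euclidean plane (the sheet of paper). -/
abbrev Plane : Type := EuclideanSpace ℝ (Fin 2)

/-- `p` has a neighborhood on which `φ` preserves distances. -/
def IsUnfoldedPoint (φ : Plane → Plane) (p : Plane) : Prop :=
  ∃ N ∈ nhds p, ∀ x ∈ N, ∀ y ∈ N, dist (φ x) (φ y) = dist x y

/-- `p` has a neighborhood covered by two sets, each containing `p`, which `φ` maps by two
different isometries of the plane. Unfolded points are excluded explicitly, since the
covering condition alone also holds at an unfolded point (cover a neighborhood by itself and the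
singleton `{p}`). -/
def IsCreasePoint (φ : Plane → Plane) (p : Plane) : Prop :=
  ¬ IsUnfoldedPoint φ p ∧
    ∃ N ∈ nhds p, ∃ A B : Set Plane, ∃ f g : Plane ≃ᵢ Plane,
      N ⊆ A ∪ B ∧ p ∈ A ∧ p ∈ B ∧ f ≠ g ∧ Set.EqOn φ f A ∧ Set.EqOn φ g B

/-- `p` has a neighborhood covered by finitely many sets, each containing `p` and each mapped by
`φ` as some isometry of the plane maps it, with at least three distinct isometries among
them. The other two types of points are excluded explicitly, for the same reason as above. -/
def IsVertexPoint (φ : Plane → Plane) (p : Plane) : Prop :=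
  ¬ IsUnfoldedPoint φ p ∧ ¬ IsCreasePoint φ p ∧
    ∃ N ∈ nhds p, ∃ (n : ℕ) (A : Fin n → Set Plane) (f : Fin n → Plane ≃ᵢ Plane),
      N ⊆ (⋃ i, A i) ∧ (∀ i, p ∈ A i ∧ Set.EqOn φ (f i) (A i)) ∧
        3 ≤ (Set.range f).ncard

/-- A local flat folding of the plane. -/
structure IsLocalFlatFolding (φ : Plane → Plane) : Prop where
  continuous : Continuous φ
  point_type : ∀ p, IsUnfoldedPoint φ p ∨ IsCreasePoint φ p ∨ IsVertexPoint φ p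
  exists_vertexPoint : ∃ p, IsVertexPoint φ p

/-- The ray with apex `p` and direction `d`, without its apex. -/
def openRay (p d : Plane) : Set Plane :=
  {x | ∃ t : ℝ, 0 < t ∧ x = p + t • d}

/-- Labels for the edges: unordered pairs of points (for segments between two vertex points), and
pairs of an apex and a unit direction (for rays). -/
abbrev EdgeLabel : Type := Sym2 Plane ⊕ (Plane × Metric.sphere (0 : Plane) 1)

/-- `p` and `q` are distinct vertex points, with only crease points strictly between them. -/
def IsSegmentEdge (φ : Plane → Plane) (p q : Plane) : Prop :=
  IsVertexPoint φ p ∧ IsVertexPoint φ q ∧ p ≠ q ∧ ∀ x ∈ openSegment ℝ p q, IsCreasePoint φ x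

/-- `p` is a vertex point and the ray from `p` in direction `d` consists, apart from `p`, only of
crease points. -/
def IsRayEdge (φ : Plane → Plane) (p d : Plane) : Prop :=
  IsVertexPoint φ p ∧ ∀ x ∈ openRay p d, IsCreasePoint φ x

/-- The incidence relation: a segment edge joins its two end points, and a ray edge joins its apex
to the special vertex `none`. -/
inductive FoldingLink (φ : Plane → Plane) : EdgeLabel → Option Plane → Option Plane → Prop
  | segment (p q : Plane) (h : IsSegmentEdge φ p q) :
      FoldingLink φ (Sum.inl s(p, q)) (some p) (some q)
  | ray (p : Plane) (d : Metric.sphere (0 : Plane) 1) (h : IsRayEdge φ p d) :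
      FoldingLink φ (Sum.inr (p, d)) (some p) none
  | ray_symm (p : Plane) (d : Metric.sphere (0 : Plane) 1) (h : IsRayEdge φ p d) :
      FoldingLink φ (Sum.inr (p, d)) none (some p)

/-- The graph of a local flat folding, a multigraph whose vertices are the vertex points (as
`some p`) and, if there is an infinite ray of crease points, the special vertex `∞` (as `none`). -/
def foldingGraph (φ : Plane → Plane) : Graph (Option Plane) EdgeLabel where
  vertexSet := {v | (∃ p, v = some p ∧ IsVertexPoint φ p) ∨
    (v = none ∧ ∃ p d : Plane, d ≠ 0 ∧ ∀ x ∈ openRay p d, IsCreasePoint φ x)}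
  IsLink := FoldingLink φ
  isLink_symm := by
    intro e _
    refine ⟨fun x y h => ?_⟩
    cases h with
    | segment p q h =>
      rw [Sym2.eq_swap]
      refine FoldingLink.segment q p ⟨h.2.1, h.1, h.2.2.1.symm, ?_⟩
      rw [openSegment_symm]
      exact h.2.2.2
    | ray p d h => exact FoldingLink.ray_symm p d h
    | ray_symm p d h => exact FoldingLink.ray p d h
  eq_or_eq_of_isLink_of_isLink := by
    intro e x y v w h h'
    rcases h with ⟨p, q, h⟩ | ⟨p, d, h⟩ | ⟨p, d, h⟩
    · generalize he : (Sum.inl s(p, q) : EdgeLabel) = e' at h'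
      rcases h' with ⟨p', q', h'⟩ | ⟨p', d', h'⟩ | ⟨p', d', h'⟩
      · rcases Sym2.eq_iff.1 (Sum.inl.inj he) with h1 | h1
        · exact Or.inl (by rw [h1.1])
        · exact Or.inr (by rw [h1.1])
      · cases he
      · cases he
    · cases h' <;> simp
    · cases h' <;> simp
  left_mem_of_isLink := by
    intro e x y h
    cases h with
    | segment p q h => exact Or.inl ⟨p, rfl, h.1⟩
    | ray p d h => exact Or.inl ⟨p, rfl, h.1⟩
    | ray_symm p d h => exact Or.inr ⟨rfl, p, d, ne_zero_of_mem_unit_sphere d, h.2⟩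

/-- Any two vertices of the multigraph `G` are joined by a walk in `G`. -/
def IsConnected {α β : Type*} (G : Graph α β) : Prop :=
  ∀ u ∈ G.vertexSet, ∀ w ∈ G.vertexSet, Relation.ReflTransGen G.Adj u w

/-- `v` is an articulation vertex of `G`: it is a vertex of `G` whose removal (along with all
edges incident to it) leaves a disconnected graph. -/
def IsArticulationVertex {α β : Type*} (G : Graph α β) (v : α) : Prop :=
  v ∈ G.vertexSet ∧ ¬ IsConnected (G.deleteVerts {v})

end FlatFolding

namespace FlatFolding

open Topology

/-! Near each point `p` distances to `p` are preserved, so `φ` is nonexpanding (`dist_le`), and the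
set where it agrees with a given isometry, a face if it has interior, is closed and convex
(`convex_agree`). A nonexpanding map that is isometric on a line commutes with the translations
along it. Translating a vertex point slightly would then give a vertex point nearby, but vertex
points are isolated; so no line is mapped isometrically (`not_isometric_line`). Hence no crease is a
full line, every folded (that is, not unfolded) point is a vertex point or lies on a crease with a
vertex end (`exists_isAttached`), and no face contains a line, which makes its frontier connected.

If `G - ∞` were disconnected, the folded points would split, according to the vertex points they are
attached to, into two nonempty closed classes. On a segment from one class to the other, a closest
pair has only unfolded points in between and so spans a chord of one face. The frontier of this face
is folded and contains a connected set joining the pair (`exists_preconnected_folded`), which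
contradicts the splitting (`not_separated`). -/

/-! ### Isometries of the plane. -/

/-- The vector `v` rotated by a right angle. -/
def perp (v : Plane) : Plane := !₂[-v 1, v 0]

lemma inner_eq (v w : Plane) : inner ℝ v w = v 0 * w 0 + v 1 * w 1 := by
  simp [PiLp.inner_apply, Fin.sum_univ_two, mul_comm]

lemma inner_perp (v : Plane) : inner ℝ v (perp v) = 0 := by
  simp [inner_eq, perp, mul_comm]

lemma norm_perp (v : Plane) : ‖perp v‖ = ‖v‖ := by
  simp [EuclideanSpace.norm_eq, Fin.sum_univ_two, perp, add_comm]

lemma eq_smul_add_smul_perp {d : Plane} (hd : d ≠ 0) (v : Plane) :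
    ∃ α β : ℝ, v = α • d + β • perp d := by
  have h : d 0 * d 0 + d 1 * d 1 ≠ 0 := by
    rw [← inner_eq]; exact inner_self_ne_zero.2 hd
  refine ⟨(d 0 * v 0 + d 1 * v 1) / (d 0 * d 0 + d 1 * d 1),
    (d 0 * v 1 - d 1 * v 0) / (d 0 * d 0 + d 1 * d 1), ?_⟩
  ext i
  fin_cases i
  · change v 0 = _ / _ * d 0 + _ / _ * (-d 1)
    rw [div_mul_eq_mul_div, div_mul_eq_mul_div, ← add_div, eq_div_iff h]
    ring
  · change v 1 = _ / _ * d 1 + _ / _ * d 0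
    rw [div_mul_eq_mul_div, div_mul_eq_mul_div, ← add_div, eq_div_iff h]
    ring

lemma exists_linearIsometryEquiv (f : Plane ≃ᵢ Plane) :
    ∃ L : Plane ≃ₗᵢ[ℝ] Plane, ∀ p v, f (p + v) = f p + L v := by
  refine ⟨f.toRealAffineIsometryEquiv.linearIsometryEquiv, fun p v => ?_⟩
  have := f.toRealAffineIsometryEquiv.map_vadd p v
  simp only [vadd_eq_add, IsometryEquiv.coeFn_toRealAffineIsometryEquiv] at this
  rw [add_comm, this, add_comm]

lemma isometryEquiv_ext_of_perp {f g : Plane ≃ᵢ Plane} {p d : Plane} (hd : d ≠ 0)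
    (h0 : f p = g p) (h1 : f (p + d) = g (p + d)) (h2 : f (p + perp d) = g (p + perp d)) :
    f = g := by
  obtain ⟨L, hL⟩ := exists_linearIsometryEquiv f
  obtain ⟨M, hM⟩ := exists_linearIsometryEquiv g
  rw [hL, hM, h0, add_right_inj] at h1 h2
  ext1 x
  obtain ⟨α, β, h⟩ := eq_smul_add_smul_perp hd (x - p)
  have hx : x = p + (α • d + β • perp d) := by rw [← h]; abel
  rw [hx, hL, hM]
  simp [h0, h1, h2]

/-- Two isometries that agree near a point are equal. -/
lemma isometryEquiv_ext_of_eventually {f g : Plane ≃ᵢ Plane} {p : Plane}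
    (h : ∀ᶠ x in 𝓝 p, f x = g x) : f = g := by
  obtain ⟨r, hr, h⟩ := Metric.eventually_nhds_iff.1 h
  let e : Plane := EuclideanSpace.single 0 1
  have he : ‖e‖ = 1 := by simp [e]
  have hn : ‖(r / 2) • e‖ = r / 2 := by
    rw [norm_smul, he, mul_one, Real.norm_of_nonneg (by positivity)]
  refine isometryEquiv_ext_of_perp (p := p) (d := (r / 2) • e) ?_ ?_ ?_ ?_
  · rw [← norm_pos_iff, hn]; positivity
  · exact h (by simpa using hr)
  · apply h; rw [dist_self_add_left, hn]; linarith
  · apply h; rw [dist_self_add_left, norm_perp, hn]; linarith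

/-- At most two isometries have given values at two given points. -/
lemma eq_or_eq_of_isometryEquiv {f g h : Plane ≃ᵢ Plane} {p q : Plane} (hpq : p ≠ q)
    (hfp : f p = g p) (hfq : f q = g q) (hhp : h p = g p) (hhq : h q = g q) (hfg : f ≠ g) :
    h = f ∨ h = g := by
  have hd : q - p ≠ 0 := sub_ne_zero.2 hpq.symm
  set x := p + perp (q - p) with hx
  have key : ∀ {f g : Plane ≃ᵢ Plane}, f p = g p → f q = g q → f x = g x → f = g := by
    intro f g h0 h1 h2
    exact isometryEquiv_ext_of_perp hd h0 (by simpa using h1) h2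
  have hne : f x ≠ g x := fun h => hfg (key hfp hfq h)
  -- The images of `x` lie on two circles with distinct centers `g p` and `g q`, which meet in at
  -- most two points.
  rcases EuclideanGeometry.eq_of_dist_eq_of_dist_eq_of_finrank_eq_two (by simp)
    (c₁ := g p) (c₂ := g q) (p₁ := f x) (p₂ := g x) (p := h x) (r₁ := dist x p)
    (r₂ := dist x q) (by simpa using hpq) hne (by rw [← hfp, f.dist_eq]) (g.dist_eq _ _)
    (by rw [← hhp, h.dist_eq]) (by rw [← hfq, f.dist_eq]) (g.dist_eq _ _)
    (by rw [← hhq, h.dist_eq]) with h' | h'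
  · exact Or.inl (key (hhp.trans hfp.symm) (hhq.trans hfq.symm) h')
  · exact Or.inr (key hhp hhq h')

/-! ### Unfolded and crease points in terms of covering isometries. -/

/-- A map that preserves distances near a point is near that point an isometry of the plane. -/
lemma IsUnfoldedPoint.exists_isometryEquiv {φ : Plane → Plane} {p : Plane}
    (h : IsUnfoldedPoint φ p) : ∃ f : Plane ≃ᵢ Plane, ∀ᶠ x in 𝓝 p, φ x = f x := by
  obtain ⟨N, hN, h⟩ := h
  obtain ⟨r, hr, hB⟩ := Metric.mem_nhds_iff.1 hN
  replace h : ∀ v w : Plane, ‖v‖ < r → ‖w‖ < r →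
      ‖(φ (p + v) - φ p) - (φ (p + w) - φ p)‖ = ‖v - w‖ := by
    intro v w hv hw
    have := h (p + v) (hB (by simpa using hv)) (p + w) (hB (by simpa using hw))
    rw [dist_eq_norm, dist_eq_norm] at this
    simpa using this
  set ψ : Plane → Plane := fun v => φ (p + v) - φ p with hψ
  have hnorm : ∀ v, ‖v‖ < r → ‖ψ v‖ = ‖v‖ := by
    intro v hv
    simpa [hψ] using h v 0 hv (by simpa using hr)
  have hinner : ∀ v w, ‖v‖ < r → ‖w‖ < r → inner ℝ (ψ v) (ψ w) = inner ℝ v w := by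
    intro v w hv hw
    have h1 := norm_sub_sq_real (ψ v) (ψ w)
    have h2 := norm_sub_sq_real v w
    rw [h v w hv hw, hnorm v hv, hnorm w hw] at h1
    linarith
  let b := EuclideanSpace.basisFun (Fin 2) ℝ
  let s := r / 2
  have hs : 0 < s := by positivity
  have hsb : ∀ i, ‖s • b i‖ < r := by
    intro i
    rw [norm_smul, b.orthonormal.1 i, mul_one, Real.norm_of_nonneg hs.le]
    exact half_lt_self hr
  -- The basis is shrunk by `s` to fit into the ball; its rescaled image is orthonormal because `ψ`
  -- preserves inner products, and it determines the linear part `L`.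
  let a : Fin 2 → Plane := fun i => s⁻¹ • ψ (s • b i)
  have ha : Orthonormal ℝ a := by
    rw [orthonormal_iff_ite]
    intro i j
    simp only [a, real_inner_smul_left, real_inner_smul_right]
    rw [hinner _ _ (hsb i) (hsb j), real_inner_smul_left, real_inner_smul_right,
      orthonormal_iff_ite.1 b.orthonormal i j]
    field_simp
  obtain ⟨a', ha'⟩ := Orthonormal.exists_orthonormalBasis_extension_of_card_eq
    (ι := Fin 2) (by simp) (v := a) (s := Set.univ) (ha.comp _ Subtype.val_injective)
  let L : Plane ≃ₗᵢ[ℝ] Plane := b.equiv a' (Equiv.refl _)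
  have hL : ∀ v, ‖v‖ < r → ψ v = L v := by
    intro v hv
    refine a'.repr.injective (PiLp.ext fun i => ?_)
    have h1 : a' i = L (b i) := by simp [L]
    rw [a'.repr_apply_apply, a'.repr_apply_apply]
    conv_rhs => rw [h1, L.inner_map_map]
    rw [ha' i trivial]
    simp only [a, real_inner_smul_left]
    rw [hinner _ _ (hsb i) hv, real_inner_smul_left]
    field_simp
  refine ⟨((IsometryEquiv.subRight p).trans L.toIsometryEquiv).trans
    (IsometryEquiv.addRight (φ p)), Metric.eventually_nhds_iff.2 ⟨r, hr, fun x hx => ?_⟩⟩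
  rw [dist_eq_norm] at hx
  have := hL _ hx
  simp only [hψ, add_sub_cancel] at this
  simp [← this]

lemma isUnfoldedPoint_of_eventually_eq {φ : Plane → Plane} {p : Plane} (f : Plane ≃ᵢ Plane)
    (h : ∀ᶠ x in 𝓝 p, φ x = f x) : IsUnfoldedPoint φ p :=
  ⟨_, h, fun x hx y hy => by
    rw [Set.mem_ofPred_eq] at hx hy; rw [hx, hy, f.dist_eq]⟩

lemma isOpen_setOf_isUnfoldedPoint (φ : Plane → Plane) : IsOpen {p | IsUnfoldedPoint φ p} := by
  rw [isOpen_iff_mem_nhds]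
  intro p hp
  obtain ⟨f, h⟩ := hp.exists_isometryEquiv
  exact h.eventually_nhds.mono fun x hx => isUnfoldedPoint_of_eventually_eq f hx

lemma isUnfolded_or_isCrease_of_cover {φ : Plane → Plane} {p : Plane} (f g : Plane ≃ᵢ Plane)
    (hf : f p = φ p) (hg : g p = φ p) (h : ∀ᶠ x in 𝓝 p, φ x = f x ∨ φ x = g x) :
    IsUnfoldedPoint φ p ∨ IsCreasePoint φ p := by
  by_cases hU : IsUnfoldedPoint φ p
  · exact Or.inl hU
  refine Or.inr ⟨hU, _, h, {x | φ x = f x}, {x | φ x = g x}, f, g, fun x hx => hx, hf.symm,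
    hg.symm, ?_, fun x hx => hx, fun x hx => hx⟩
  rintro rfl
  exact hU (isUnfoldedPoint_of_eventually_eq f (by simpa using h))

lemma IsCreasePoint.exists_cover {φ : Plane → Plane} {p : Plane} (h : IsCreasePoint φ p) :
    ∃ f g : Plane ≃ᵢ Plane, f p = φ p ∧ g p = φ p ∧ f ≠ g ∧
      ∀ᶠ x in 𝓝 p, φ x = f x ∨ φ x = g x := by
  obtain ⟨-, N, hN, A, B, f, g, hc, hA, hB, hne, hf, hg⟩ := h
  refine ⟨f, g, (hf hA).symm, (hg hB).symm, hne, Filter.mem_of_superset hN fun x hx => ?_⟩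
  exact (hc hx).imp (fun h => hf h) (fun h => hg h)

/-- Near every point, a local flat folding agrees pointwise with one of finitely many isometries,
all with the right value at that point. -/
lemma IsLocalFlatFolding.exists_finite_cover {φ : Plane → Plane} (hφ : IsLocalFlatFolding φ)
    (p : Plane) : ∃ S : Set (Plane ≃ᵢ Plane), S.Finite ∧ (∀ f ∈ S, f p = φ p) ∧
      ∀ᶠ x in 𝓝 p, ∃ f ∈ S, φ x = f x := by
  rcases hφ.point_type p with h | h | h
  · obtain ⟨f, hf⟩ := h.exists_isometryEquiv
    exact ⟨{f}, Set.finite_singleton f, by simpa using hf.self_of_nhds.symm, by simpa using hf⟩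
  · obtain ⟨f, g, hf, hg, -, h⟩ := h.exists_cover
    exact ⟨{f, g}, by simp, by simp [hf, hg], by simpa using h⟩
  · obtain ⟨-, -, N, hN, n, A, f, hc, hf, -⟩ := h
    refine ⟨Set.range f, Set.finite_range f, ?_, Filter.mem_of_superset hN fun x hx => ?_⟩
    · rintro _ ⟨i, rfl⟩
      exact ((hf i).2 (hf i).1).symm
    · obtain ⟨i, hi⟩ := Set.mem_iUnion.1 (hc hx)
      exact ⟨f i, ⟨i, rfl⟩, (hf i).2 hi⟩

/-! ### Nonexpansion and convexity of faces. -/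

/-- All isometries covering a neighborhood of `p` have the value `φ p` at `p`, so distances to `p`
are preserved nearby. Continuous induction along the segment from `x` to `y` adds these local
equalities up. -/
lemma IsLocalFlatFolding.dist_le {φ : Plane → Plane} (hφ : IsLocalFlatFolding φ) (x y : Plane) :
    dist (φ x) (φ y) ≤ dist x y := by
  have hloc : ∀ p, ∀ᶠ q in 𝓝 p, dist (φ p) (φ q) = dist p q := by
    intro p
    obtain ⟨S, -, hS, h⟩ := hφ.exists_finite_cover p
    filter_upwards [h] with q ⟨f, hf, hq⟩
    rw [hq, ← hS f hf, f.dist_eq]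
  let γ : ℝ → Plane := AffineMap.lineMap x y
  have hγ : Continuous γ := AffineMap.lineMap_continuous
  have hγd : ∀ s t, dist (γ s) (γ t) = dist s t * dist x y := fun s t => dist_lineMap_lineMap x y s t
  have key : Set.Icc (0 : ℝ) 1 ⊆ {t | dist (φ x) (φ (γ t)) ≤ t * dist x y} := by
    apply IsClosed.Icc_subset_of_forall_mem_nhdsWithin
    · refine IsClosed.inter (isClosed_le ?_ (by fun_prop)) isClosed_Icc
      exact continuous_const.dist (hφ.continuous.comp hγ)
    · simp [γ]
    · rintro t ⟨ht, -⟩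
      have h := (hγ.tendsto t).eventually (hloc (γ t))
      filter_upwards [nhdsWithin_le_nhds h, self_mem_nhdsWithin] with u hu htu
      rw [Set.mem_Ioi] at htu
      rw [hγd, Real.dist_eq, abs_sub_comm, abs_of_pos (sub_pos.2 htu)] at hu
      have h3 := dist_triangle (φ x) (φ (γ t)) (φ (γ u))
      simp only [Set.mem_ofPred_eq] at ht ⊢
      linarith
  have := key (Set.right_mem_Icc.2 zero_le_one)
  simpa [γ] using this

lemma isClosed_agree {φ : Plane → Plane} (hφ : Continuous φ) (f : Plane ≃ᵢ Plane) :
    IsClosed {x | φ x = f x} :=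
  isClosed_eq hφ f.continuous

/-- A distance-nonincreasing map of the plane agrees with any given isometry on a convex set. -/
lemma convex_agree {φ : Plane → Plane} (hφ : ∀ x y, dist (φ x) (φ y) ≤ dist x y)
    (f : Plane ≃ᵢ Plane) : Convex ℝ {x | φ x = f x} := by
  rw [convex_iff_segment_subset]
  intro x (hx : φ x = f x) y (hy : φ y = f y) z hz
  rw [segment_eq_image_lineMap] at hz
  obtain ⟨t, ht, rfl⟩ := hz
  set z := AffineMap.lineMap x y t
  have h1 : dist x z = t * dist x y := by
    simp [z, dist_left_lineMap, abs_of_nonneg ht.1]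
  have h2 : dist z y = (1 - t) * dist x y := by
    rw [dist_lineMap_right, Real.norm_of_nonneg (sub_nonneg.2 ht.2)]
  have h3 : dist (f x) (f y) = dist x y := f.dist_eq x y
  have h4 := hφ x z
  have h5 := hφ z y
  have h6 := dist_triangle (φ x) (φ z) (φ y)
  rw [hx] at h4 h6
  rw [hy] at h5 h6
  -- The triangle inequality is an equality here, so strict convexity places `φ z` on the segment in
  -- the ratio `t`.
  have e1 : φ z = AffineMap.lineMap (f x) (f y) t :=
    eq_lineMap_of_dist_eq_mul_of_dist_eq_mul (by rw [h3]; linarith) (by rw [h3]; linarith)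
  have e2 : f z = AffineMap.lineMap (f x) (f y) t :=
    eq_lineMap_of_dist_eq_mul_of_dist_eq_mul (by rw [f.dist_eq, h1, h3])
      (by rw [f.dist_eq, h2, h3])
  exact e1.trans e2.symm

lemma IsLocalFlatFolding.convex_agree {φ : Plane → Plane} (hφ : IsLocalFlatFolding φ)
    (f : Plane ≃ᵢ Plane) : Convex ℝ {x | φ x = f x} :=
  FlatFolding.convex_agree hφ.dist_le f

lemma mem_interior_agree_iff {φ : Plane → Plane} {f : Plane ≃ᵢ Plane} {x : Plane} :
    x ∈ interior {x | φ x = f x} ↔ ∀ᶠ y in 𝓝 x, φ y = f y :=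
  mem_interior_iff_mem_nhds

/-! ### Local structure around a point. -/

/-- Near any point `p`, a local flat folding is positively homogeneous with respect to `p`, and
`p` is the only vertex point. -/
lemma IsLocalFlatFolding.exists_homogeneous_ball {φ : Plane → Plane} (hφ : IsLocalFlatFolding φ)
    (p : Plane) : ∃ r > 0, (∀ v, ‖v‖ < r → ∀ t ∈ Set.Icc (0 : ℝ) 1,
        φ (p + t • v) = φ p + t • (φ (p + v) - φ p)) ∧
      ∀ q ∈ Metric.ball p r, q ≠ p → ¬ IsVertexPoint φ q := by
  obtain ⟨S, hfin, hS, h⟩ := hφ.exists_finite_cover p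
  obtain ⟨r, hr, h⟩ := Metric.eventually_nhds_iff.1 h
  refine ⟨r, hr, ?_, ?_⟩
  · intro v hv t ht
    obtain ⟨f, hf, hfv⟩ := h (y := p + v) (by simpa using hv)
    have hseg : φ (p + t • v) = f (p + t • v) := by
      have := (hφ.convex_agree f).add_smul_mem (x := p) (y := v) (hS f hf).symm hfv ht
      exact this
    obtain ⟨L, hL⟩ := exists_linearIsometryEquiv f
    rw [hseg, hfv, ← hS f hf, hL, hL]
    simp
  · intro q hq hqp hv
    obtain ⟨f, hf, hfq⟩ := h hq
    -- Agreement sets are closed, so an isometry with the wrong value at `q` is not used near `q`.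
    -- The remaining ones agree at both `p` and `q`, which leaves at most two.
    have hnear : ∀ᶠ x in 𝓝 q, ∃ g ∈ S, g q = φ q ∧ φ x = g x := by
      have h1 : ∀ᶠ x in 𝓝 q, ∀ g ∈ S, g q ≠ φ q → φ x ≠ g x := by
        rw [hfin.eventually_all]
        intro g hg
        by_cases hgq : g q = φ q
        · simp [hgq]
        · filter_upwards [(isClosed_agree hφ.continuous g).isOpen_compl.mem_nhds (x := q)
            (fun h => hgq h.symm)] with x hx _
          exact hx
      filter_upwards [h1, Metric.isOpen_ball.mem_nhds hq] with x hx hxr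
      obtain ⟨g, hg, hgx⟩ := h hxr
      exact ⟨g, hg, by_contra fun hne => hx g hg hne hgx, hgx⟩
    have h2 : ∃ g : Plane ≃ᵢ Plane, g q = φ q ∧ ∀ᶠ x in 𝓝 q, φ x = f x ∨ φ x = g x := by
      by_cases hg : ∃ g ∈ S, g q = φ q ∧ g ≠ f
      · obtain ⟨g, hg, hgq, hgf⟩ := hg
        refine ⟨g, hgq, hnear.mono fun x ⟨k, hk, hkq, hkx⟩ => ?_⟩
        rcases eq_or_eq_of_isometryEquiv hqp.symm (f := f) (g := g) (h := k)
          ((hS f hf).trans (hS g hg).symm) (hfq.symm.trans hgq.symm)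
          ((hS k hk).trans (hS g hg).symm) (hkq.trans hgq.symm) hgf.symm with rfl | rfl
        · exact Or.inl hkx
        · exact Or.inr hkx
      · push Not at hg
        refine ⟨f, hfq.symm, hnear.mono fun x ⟨k, hk, hkq, hkx⟩ => Or.inl ?_⟩
        rw [← hg k hk hkq, hkx]
    obtain ⟨g, hg, h3⟩ := h2
    rcases isUnfolded_or_isCrease_of_cover f g hfq.symm hg h3 with h | h
    · exact hv.1 h
    · exact hv.2.1 h

lemma IsLocalFlatFolding.isCreasePoint_of {φ : Plane → Plane} (hφ : IsLocalFlatFolding φ)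
    {p : Plane} (h1 : ¬ IsUnfoldedPoint φ p) (h2 : ¬ IsVertexPoint φ p) : IsCreasePoint φ p :=
  ((hφ.point_type p).resolve_left h1).resolve_right h2

/-- The set of folded points is star-shaped near each point. -/
lemma IsLocalFlatFolding.eventually_isCreasePoint {φ : Plane → Plane}
    (hφ : IsLocalFlatFolding φ) (p : Plane) :
    ∀ᶠ q in 𝓝 p, ¬ IsUnfoldedPoint φ q → q ≠ p →
      IsCreasePoint φ q ∧ ∀ x ∈ openSegment ℝ p q, IsCreasePoint φ x := by
  obtain ⟨r, hr, hhom, hver⟩ := hφ.exists_homogeneous_ball p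
  refine Metric.eventually_nhds_iff.2 ⟨r, hr, fun q hq hU hqp => ?_⟩
  refine ⟨hφ.isCreasePoint_of hU (hver q hq hqp), ?_⟩
  rw [openSegment_eq_image']
  rintro _ ⟨t, ⟨ht0, ht1⟩, rfl⟩
  have hv : ‖q - p‖ < r := by rwa [← dist_eq_norm]
  have hqp' : q - p ≠ 0 := sub_ne_zero.2 hqp
  refine hφ.isCreasePoint_of (fun hx => hU ?_) (hver _ ?_ ?_)
  -- Homogeneity scales a distance-preserving neighborhood of the intermediate point up to one of
  -- `q`.
  · obtain ⟨N, hN, hiso⟩ := hx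
    refine ⟨{y | p + t • (y - p) ∈ N} ∩ Metric.ball p r, Filter.inter_mem ?_
      (Metric.isOpen_ball.mem_nhds hq), ?_⟩
    · exact (show Continuous fun y => p + t • (y - p) by fun_prop).continuousAt hN
    · rintro y ⟨hy, hyr⟩ z ⟨hz, hzr⟩
      have h1 := hiso _ hy _ hz
      rw [Metric.mem_ball, dist_eq_norm] at hyr hzr
      rw [hhom _ hyr t ⟨ht0.le, ht1.le⟩, hhom _ hzr t ⟨ht0.le, ht1.le⟩, dist_add_left,
        dist_add_left, dist_smul₀, dist_smul₀, dist_sub_right, dist_sub_right] at h1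
      simpa [ht0.ne'] using h1
  · rw [mem_ball_iff_norm, add_sub_cancel_left, norm_smul, Real.norm_of_nonneg ht0.le]
    nlinarith [norm_nonneg (q - p)]
  · simpa [ht0.ne'] using hqp'

/-! ### Crease directions. -/

/-- Near `p`, the folded points are the points of the line through `p` with direction `d`, they
are crease points, and the map is affine and length-preserving along this line. -/
def IsCreaseDirection (φ : Plane → Plane) (p d : Plane) : Prop :=
  (∀ᶠ x in 𝓝 p, ¬ IsUnfoldedPoint φ x → ∃ s : ℝ, x = p + s • d) ∧
    (∀ᶠ s in 𝓝 (0 : ℝ), IsCreasePoint φ (p + s • d)) ∧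
    ∃ d' : Plane, ‖d'‖ = ‖d‖ ∧ ∀ᶠ s in 𝓝 (0 : ℝ), φ (p + s • d) = φ p + s • d'

lemma tendsto_add_smul (p e : Plane) : Filter.Tendsto (fun s : ℝ => p + s • e) (𝓝 0) (𝓝 p) := by
  have : Continuous fun s : ℝ => p + s • e := by fun_prop
  simpa using this.tendsto 0

lemma exists_ker_eq_line (l : Plane →L[ℝ] ℝ) {e : Plane} (he : 0 < l e) :
    ∃ d : Plane, d ≠ 0 ∧ ∀ v, l v = 0 ↔ ∃ s : ℝ, v = s • d := by
  have he0 : e ≠ 0 := by rintro rfl; simp at he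
  set c := l (perp e) / l e
  have hd : l (perp e - c • e) = 0 := by
    simp [c, div_mul_cancel₀ _ he.ne']
  refine ⟨perp e - c • e, ?_, fun v => ⟨fun hv => ?_, ?_⟩⟩
  · intro h
    have h1 : inner ℝ e (perp e - c • e) = 0 := by rw [h, inner_zero_right]
    rw [inner_sub_right, inner_perp, real_inner_smul_right] at h1
    have hc : c = 0 := by
      have := inner_self_ne_zero (𝕜 := ℝ).2 he0
      simpa [this, he0] using h1
    rw [hc, zero_smul, sub_zero, ← norm_eq_zero, norm_perp, norm_eq_zero] at h
    exact he0 h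
  · obtain ⟨α, β, h⟩ := eq_smul_add_smul_perp he0 v
    have h2 : v = (α + β * c) • e + β • (perp e - c • e) := by rw [h]; module
    rw [h2, map_add, map_smul, map_smul, hd] at hv
    have h3 : α + β * c = 0 := by simpa [he.ne'] using hv
    exact ⟨β, by rw [h2, h3]; simp⟩
  · rintro ⟨s, rfl⟩
    rw [map_smul, hd, smul_zero]

/-- At a folded point, the region of each of two covering isometries lies in a half-plane. -/
lemma exists_supporting_functional {φ : Plane → Plane} (hφ : IsLocalFlatFolding φ) {p : Plane}
    (hU : ¬ IsUnfoldedPoint φ p) {f g : Plane ≃ᵢ Plane}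
    (h : ∀ᶠ x in 𝓝 p, φ x = f x ∨ φ x = g x) :
    ∃ (l : Plane →L[ℝ] ℝ) (e : Plane), 0 < l e ∧ ∀ x, φ x = f x → l x ≤ l p := by
  have hf : p ∉ interior {x | φ x = f x} := fun h =>
    hU (isUnfoldedPoint_of_eventually_eq f (mem_interior_agree_iff.1 h))
  -- If the region of `f` had empty interior, the region of `g`, being closed, would fill a
  -- neighborhood of `p`.
  have hne : (interior {x | φ x = f x}).Nonempty := by
    by_contra hemp
    refine hU (isUnfoldedPoint_of_eventually_eq g ?_)
    filter_upwards [h.eventually_nhds] with x hx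
    by_contra hxg
    refine hemp ⟨x, mem_interior_agree_iff.2 ?_⟩
    filter_upwards [hx, (isClosed_agree hφ.continuous g).isOpen_compl.mem_nhds hxg] with y hy hyg
    exact hy.resolve_right hyg
  obtain ⟨l, hl⟩ := geometric_hahn_banach_open_point (hφ.convex_agree f).interior isOpen_interior hf
  obtain ⟨a, ha⟩ := hne
  refine ⟨l, p - a, by simpa using hl a ha, fun x hx => ?_⟩
  have h1 : x ∈ closure (interior {x | φ x = f x}) := by
    rw [(hφ.convex_agree f).closure_interior_eq_closure_of_nonempty_interior ⟨a, ha⟩]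
    exact subset_closure hx
  exact closure_minimal (fun y hy => (hl y hy).le)
    (isClosed_le l.continuous continuous_const) h1

/-- The regions of `f` and `g` lie in half-planes `l ≤ l p` and `m ≤ m p`. As the regions cover a
neighborhood of `p`, `m` is a negative multiple of `l` and the half-planes share their boundary
line. Near `p`, one isometry acts on each side and both act on the line, where unfoldedness would
force `f = g`. -/
lemma IsCreasePoint.exists_isCreaseDirection {φ : Plane → Plane} (hφ : IsLocalFlatFolding φ)
    {p : Plane} (hp : IsCreasePoint φ p) : ∃ d ≠ 0, IsCreaseDirection φ p d := by
  obtain ⟨f, g, hf, hg, hfg, hcov⟩ := hp.exists_cover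
  obtain ⟨l, e, he, hl⟩ := exists_supporting_functional hφ hp.1 hcov
  obtain ⟨m, e', he', hm⟩ := exists_supporting_functional hφ hp.1 (hcov.mono fun x => Or.symm)
  have hcov' := hcov.eventually_nhds
  have hgt : ∀ q, l p < l q → (∀ᶠ x in 𝓝 q, φ x = f x ∨ φ x = g x) → ∀ᶠ x in 𝓝 q, φ x = g x := by
    intro q hq h
    filter_upwards [h, l.continuous.continuousAt.eventually (lt_mem_nhds hq)] with x hx hlx
    exact hx.resolve_left fun h => (hl x h).not_gt hlx
  have hgt' : ∀ q, m p < m q → (∀ᶠ x in 𝓝 q, φ x = f x ∨ φ x = g x) →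
      ∀ᶠ x in 𝓝 q, φ x = f x := by
    intro q hq h
    filter_upwards [h, m.continuous.continuousAt.eventually (lt_mem_nhds hq)] with x hx hlx
    exact hx.resolve_right fun h => (hm x h).not_gt hlx
  have hpos : ∀ {P : ℝ → Prop}, (∀ᶠ s in 𝓝 (0 : ℝ), P s) → ∀ᶠ s in 𝓝[>] (0 : ℝ), P s :=
    fun h => nhdsWithin_le_nhds h
  -- Approach `q` along `q + s • e` with `s > 0`, strictly outside the half-plane of `f`.
  have hge : ∀ q, l p ≤ l q → (∀ᶠ x in 𝓝 q, φ x = f x ∨ φ x = g x) → φ q = g q := by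
    intro q hq h
    refine (isClosed_agree hφ.continuous g).mem_of_tendsto
      ((tendsto_add_smul q e).mono_left nhdsWithin_le_nhds :
        Filter.Tendsto _ (𝓝[>] (0 : ℝ)) _) ?_
    filter_upwards [hpos ((tendsto_add_smul q e).eventually h), self_mem_nhdsWithin] with s hs hs0
    refine hs.resolve_left fun h => (hl _ h).not_gt ?_
    rw [map_add, map_smul, smul_eq_mul]
    have := mul_pos hs0 he
    linarith
  have hge' : ∀ q, m p ≤ m q → (∀ᶠ x in 𝓝 q, φ x = f x ∨ φ x = g x) → φ q = f q := by
    intro q hq h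
    refine (isClosed_agree hφ.continuous f).mem_of_tendsto
      ((tendsto_add_smul q e').mono_left nhdsWithin_le_nhds :
        Filter.Tendsto _ (𝓝[>] (0 : ℝ)) _) ?_
    filter_upwards [hpos ((tendsto_add_smul q e').eventually h), self_mem_nhdsWithin] with s hs hs0
    refine hs.resolve_right fun h => (hm _ h).not_gt ?_
    rw [map_add, map_smul, smul_eq_mul]
    have := mul_pos hs0 he'
    linarith
  have hm0 : ∀ v, 0 ≤ l v → m v ≤ 0 := by
    intro v hv
    obtain ⟨s, hs, hs0⟩ := ((hpos ((tendsto_add_smul p v).eventually hcov')).and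
      self_mem_nhdsWithin).exists
    have hs0' : 0 < s := hs0
    have h1 := hm _ (hge _ (by rw [map_add, map_smul, smul_eq_mul]; nlinarith) hs)
    rw [map_add, map_smul, smul_eq_mul] at h1
    by_contra hv'
    have := mul_pos hs0' (not_le.1 hv')
    linarith
  obtain ⟨c, hc, hml⟩ : ∃ c < 0, ∀ v, m v = c * l v := by
    -- Applying `hm0` to a vector of `ker l` and to its negative shows that `m` vanishes on `ker l`.
    have hml : ∀ v, m v = m e / l e * l v := by
      intro v
      have h1 : l (v - (l v / l e) • e) = 0 := by
        simp [div_mul_cancel₀ _ he.ne']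
      have h2 := hm0 _ h1.ge
      have h3 := hm0 (-(v - (l v / l e) • e)) (by rw [map_neg, h1, neg_zero])
      rw [map_neg] at h3
      have h4 : m (v - (l v / l e) • e) = 0 := le_antisymm h2 (by linarith)
      rw [map_sub, map_smul, smul_eq_mul, sub_eq_zero] at h4
      rw [h4]; ring
    refine ⟨_, lt_of_le_of_ne (div_nonpos_of_nonpos_of_nonneg (hm0 e he.le) he.le) ?_, hml⟩
    intro h0
    rw [hml e', h0, zero_mul] at he'
    exact lt_irrefl _ he'
  have hmp : ∀ q, m q - m p = c * (l q - l p) := fun q => by rw [hml, hml]; ring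
  obtain ⟨d, hd, hker⟩ := exists_ker_eq_line l he
  have hline : ∀ q, l q = l p ↔ ∃ s : ℝ, q = p + s • d := by
    intro q
    rw [← sub_eq_zero, ← map_sub, hker]
    simp only [sub_eq_iff_eq_add']
  have hl' : ∀ s : ℝ, l (p + s • d) = l p := fun s => (hline _).2 ⟨s, rfl⟩
  have hlf : ∀ᶠ s in 𝓝 (0 : ℝ), φ (p + s • d) = f (p + s • d) := by
    filter_upwards [(tendsto_add_smul p d).eventually hcov'] with s hs
    refine hge' _ ?_ hs
    have := hmp (p + s • d)
    rw [hl', sub_self, mul_zero] at this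
    linarith
  refine ⟨d, hd, ?_, ?_, ?_⟩
  · filter_upwards [hcov'] with q hq hqU
    rw [← hline]
    rcases lt_trichotomy (l q) (l p) with h | h | h
    · have := mul_pos_of_neg_of_neg hc (sub_neg.2 h)
      exact absurd (isUnfoldedPoint_of_eventually_eq f
        (hgt' q (by rw [← sub_pos, hmp]; exact this) hq)) hqU
    · exact h
    · exact absurd (isUnfoldedPoint_of_eventually_eq g (hgt q h hq)) hqU
  · filter_upwards [(tendsto_add_smul p d).eventually hcov', hlf] with s hs hsf
    have hsg := hge _ (hl' s).ge hs
    refine (isUnfolded_or_isCrease_of_cover f g hsf.symm hsg.symm hs).resolve_left fun hU => hfg ?_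
    obtain ⟨k, hk⟩ := hU.exists_isometryEquiv
    have hfar : ∀ v, ∃ t > (0 : ℝ), (∀ᶠ x in 𝓝 (p + s • d + t • v), φ x = f x ∨ φ x = g x) ∧
        ∀ᶠ x in 𝓝 (p + s • d + t • v), φ x = k x := fun v =>
      let ⟨t, ⟨h1, h2⟩, h3⟩ := ((hpos ((tendsto_add_smul (p + s • d) v).eventually
        (hs.eventually_nhds.and hk.eventually_nhds))).and self_mem_nhdsWithin).exists
      ⟨t, h3, h1, h2⟩
    have hkf : k = f := by
      obtain ⟨t, ht, h1, h2⟩ := hfar (-e)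
      have h3 : m p < m (p + s • d + t • -e) := by
        rw [← sub_pos, hmp, map_add, hl', map_smul, map_neg, smul_eq_mul]
        have := mul_pos ht he
        exact mul_pos_of_neg_of_neg hc (by linarith)
      exact isometryEquiv_ext_of_eventually ((hgt' _ h3 h1).mp (h2.mono fun x h h' => h ▸ h'))
    have hkg : k = g := by
      obtain ⟨t, ht, h1, h2⟩ := hfar e
      have h3 : l p < l (p + s • d + t • e) := by
        rw [map_add, hl', map_smul, smul_eq_mul]
        have := mul_pos ht he
        linarith
      exact isometryEquiv_ext_of_eventually ((hgt _ h3 h1).mp (h2.mono fun x h h' => h ▸ h'))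
    exact hkf.symm.trans hkg
  · obtain ⟨L, hL⟩ := exists_linearIsometryEquiv f
    refine ⟨L d, L.norm_map d, hlf.mono fun s hs => ?_⟩
    rw [hs, hL, hf, map_smul]

lemma IsCreaseDirection.smul {φ : Plane → Plane} {p d : Plane} (h : IsCreaseDirection φ p d)
    {c : ℝ} (hc : c ≠ 0) : IsCreaseDirection φ p (c • d) := by
  obtain ⟨h1, h2, d', hd', h3⟩ := h
  have ht : Filter.Tendsto (fun s : ℝ => s * c) (𝓝 0) (𝓝 0) := by
    simpa using (continuous_mul_const c).tendsto 0
  refine ⟨h1.mono fun x hx hU => ?_, (ht.eventually h2).mono fun s hs => ?_, c • d', ?_,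
    (ht.eventually h3).mono fun s hs => ?_⟩
  · obtain ⟨s, rfl⟩ := hx hU
    exact ⟨s / c, by rw [smul_smul, div_mul_cancel₀ _ hc]⟩
  · rwa [smul_smul]
  · rw [norm_smul, norm_smul, hd']
  · rwa [smul_smul, smul_smul]

/-- A direction in which crease points accumulate at a crease point is its crease direction. -/
lemma IsCreasePoint.isCreaseDirection {φ : Plane → Plane} (hφ : IsLocalFlatFolding φ)
    {p d : Plane} (hp : IsCreasePoint φ p)
    (h : ∃ᶠ s in 𝓝[≠] (0 : ℝ), IsCreasePoint φ (p + s • d)) (hd : d ≠ 0) :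
    IsCreaseDirection φ p d := by
  obtain ⟨e, he, hdir⟩ := hp.exists_isCreaseDirection hφ
  have h1 := ((tendsto_add_smul p d).mono_left
    (nhdsWithin_le_nhds (s := {(0 : ℝ)}ᶜ))).eventually hdir.1
  obtain ⟨s, hs, h2, hs0⟩ := (h.and_eventually (h1.and self_mem_nhdsWithin)).exists
  have hs0' : s ≠ 0 := hs0
  obtain ⟨w, hw⟩ := h2 hs.1
  have hde : d = (w / s) • e := by
    rw [div_eq_inv_mul, mul_smul, ← add_left_cancel hw, inv_smul_smul₀ hs0']
  have hc : w / s ≠ 0 := by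
    rintro h0
    rw [h0, zero_smul] at hde
    exact hd hde
  rw [hde]
  exact hdir.smul hc

/-- A distance-nonincreasing map that maps a line isometrically commutes with the translations
along this line. -/
lemma translation_equivariant_of_line {φ : Plane → Plane}
    (hφ : ∀ x y, dist (φ x) (φ y) ≤ dist x y) {z d d' : Plane} (hd : ‖d'‖ = ‖d‖)
    (h : ∀ s : ℝ, φ (z + s • d) = φ z + s • d') (q : Plane) (s : ℝ) :
    φ (q + s • d) = φ q + s • d' := by
  have key : ∀ q, inner ℝ (φ q - φ z) d' = inner ℝ (q - z) d := by
    intro q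
    -- Squaring the distances to `z + s • d` cancels the quadratic terms; a linear function of `s`
    -- bounded above has slope zero.
    have h1 : ∀ s : ℝ, 2 * s * (inner ℝ (q - z) d - inner ℝ (φ q - φ z) d') ≤
        ‖q - z‖ ^ 2 - ‖φ q - φ z‖ ^ 2 := by
      intro s
      have h2 := hφ q (z + s • d)
      rw [h, dist_eq_norm, dist_eq_norm, ← sub_sub, ← sub_sub] at h2
      have h3 := pow_le_pow_left₀ (norm_nonneg _) h2 2
      rw [norm_sub_sq_real _ (s • d'), norm_sub_sq_real _ (s • d), norm_smul, norm_smul, hd, real_inner_smul_right,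
        real_inner_smul_right] at h3
      linarith
    set u := inner ℝ (q - z) d - inner ℝ (φ q - φ z) d' with hu
    set b := ‖q - z‖ ^ 2 - ‖φ q - φ z‖ ^ 2
    by_contra hne
    have hu0 : u ≠ 0 := fun h0 => hne (by linarith)
    have h4 := h1 ((b + 1) / (2 * u))
    rw [show 2 * ((b + 1) / (2 * u)) * u = b + 1 by field_simp] at h4
    linarith
  -- The displacement has the same inner product with `d'` as `s • d'` and is no longer than it, so
  -- the two are equal.
  have h1 : inner ℝ (φ (q + s • d) - φ q) d' = s * ‖d‖ ^ 2 := by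
    have h2 := key (q + s • d)
    have h3 := key q
    rw [show φ (q + s • d) - φ q = (φ (q + s • d) - φ z) - (φ q - φ z) by abel, inner_sub_left,
      h2, h3, ← inner_sub_left, show q + s • d - z - (q - z) = s • d by abel,
      real_inner_smul_left, real_inner_self_eq_norm_sq]
  have h2 : ‖φ (q + s • d) - φ q‖ ≤ ‖s • d‖ := by
    have := hφ (q + s • d) q
    rwa [dist_eq_norm, dist_eq_norm, add_sub_cancel_left] at this
  have h3 := norm_sub_sq_real (φ (q + s • d) - φ q) (s • d')
  rw [real_inner_smul_right, h1, norm_smul, hd] at h3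
  have h4 := pow_le_pow_left₀ (norm_nonneg _) h2 2
  rw [norm_smul, mul_pow, Real.norm_eq_abs, sq_abs] at h4
  rw [mul_pow, Real.norm_eq_abs, sq_abs] at h3
  have h5 : ‖φ (q + s • d) - φ q - s • d'‖ ^ 2 ≤ 0 := by rw [h3]; linarith
  have h6 : φ (q + s • d) - φ q - s • d' = 0 := by
    simpa using le_antisymm h5 (sq_nonneg _)
  rw [sub_sub, sub_eq_zero] at h6
  exact h6

/-- Conjugating with the translations by `a` and `b` carries a cover at `p + a` back to `p`.
Allowing `f = g` treats unfolded and crease points alike. -/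
lemma isUnfolded_or_isCrease_of_translate {φ : Plane → Plane} {a b : Plane}
    (h : ∀ x, φ (x + a) = φ x + b) {p : Plane} (hp : ∃ f g : Plane ≃ᵢ Plane, f (p + a) = φ (p + a) ∧
      g (p + a) = φ (p + a) ∧ ∀ᶠ x in 𝓝 (p + a), φ x = f x ∨ φ x = g x) :
    IsUnfoldedPoint φ p ∨ IsCreasePoint φ p := by
  obtain ⟨f, g, hf, hg, hcov⟩ := hp
  let T : (Plane ≃ᵢ Plane) → (Plane ≃ᵢ Plane) := fun k =>
    ((IsometryEquiv.addRight a).trans k).trans (IsometryEquiv.addRight (-b))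
  have hT : ∀ k x, T k x = k (x + a) - b := fun k x => by simp [T, sub_eq_add_neg]
  refine isUnfolded_or_isCrease_of_cover (T f) (T g) (by rw [hT, hf, h, add_sub_cancel_right])
    (by rw [hT, hg, h, add_sub_cancel_right]) ?_
  have hcont : Filter.Tendsto (fun x : Plane => x + a) (𝓝 p) (𝓝 (p + a)) :=
    (continuous_add_const a).tendsto p
  filter_upwards [hcont.eventually hcov] with x hx
  rw [hT, hT, eq_sub_iff_add_eq, eq_sub_iff_add_eq, ← h]
  exact hx

/-- A local flat folding maps no line isometrically. -/
lemma IsLocalFlatFolding.not_isometric_line {φ : Plane → Plane} (hφ : IsLocalFlatFolding φ)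
    {z d d' : Plane} (hd0 : d ≠ 0) (hd : ‖d'‖ = ‖d‖)
    (h : ∀ s : ℝ, φ (z + s • d) = φ z + s • d') : False := by
  have htr := translation_equivariant_of_line hφ.dist_le hd h
  obtain ⟨v, hv⟩ := hφ.exists_vertexPoint
  obtain ⟨r, hr, -, hver⟩ := hφ.exists_homogeneous_ball v
  obtain ⟨s, hs, hs0⟩ := ((((tendsto_add_smul v d).eventually (Metric.ball_mem_nhds v hr)).filter_mono
    (nhdsWithin_le_nhds (s := {(0 : ℝ)}ᶜ))).and self_mem_nhdsWithin).exists
  have hs0' : s ≠ 0 := hs0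
  have hnv := hver _ hs (by simp [hs0', hd0])
  rcases isUnfolded_or_isCrease_of_translate (p := v) (fun x => htr x s) (by
    rcases hφ.point_type (v + s • d) with h | h | h
    · obtain ⟨f, hf⟩ := h.exists_isometryEquiv
      exact ⟨f, f, hf.self_of_nhds.symm, hf.self_of_nhds.symm, hf.mono fun x => Or.inl⟩
    · obtain ⟨f, g, hf, hg, -, h⟩ := h.exists_cover
      exact ⟨f, g, hf, hg, h⟩
    · exact absurd h hnv) with h | h
  · exact hv.1 h
  · exact hv.2.1 h

/-- A map of the line that is locally affine is affine. -/
lemma exists_eq_add_smul_of_locally {h : ℝ → Plane} {D : ℝ → Plane}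
    (hloc : ∀ s, ∀ᶠ u in 𝓝 (0 : ℝ), h (s + u) = h s + u • D s) (s : ℝ) : h s = h 0 + s • D 0 := by
  have hloc' : ∀ s, ∀ᶠ t in 𝓝 s, h t = h s + (t - s) • D s := by
    intro s
    have : Filter.Tendsto (fun t : ℝ => t - s) (𝓝 s) (𝓝 0) := by
      simpa using (continuous_sub_right s).tendsto s
    filter_upwards [this.eventually (hloc s)] with t ht
    simpa using ht
  have haff : ∀ s t : ℝ, HasDerivAt (fun u => h s + (u - s) • D s) (D s) t := by
    intro s t
    simpa using (((hasDerivAt_id t).sub_const s).smul_const (D s)).const_add (h s)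
  have hder : ∀ s, HasDerivAt h (D s) s := fun s => (haff s s).congr_of_eventuallyEq (hloc' s)
  have hconst : IsLocallyConstant D := by
    rw [IsLocallyConstant.iff_eventually_eq]
    intro s
    filter_upwards [(hloc' s).eventually_nhds] with t ht
    exact (hder t).unique ((haff s t).congr_of_eventuallyEq ht)
  have hD : ∀ s, D s = D 0 := fun s => hconst.apply_eq_of_preconnectedSpace s 0
  have hder' : ∀ s, HasDerivAt (fun u => h u - u • D 0) 0 s := by
    intro s
    have := (hder s).sub ((hasDerivAt_id s).smul_const (D 0))
    rw [hD s, one_smul, sub_self] at this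
    exact this
  have := is_const_of_deriv_eq_zero (fun s => (hder' s).differentiableAt)
    (fun s => (hder' s).deriv) s 0
  simp only [zero_smul, sub_zero] at this
  rw [← this]; abel

/-- The creases of a local flat folding contain no line. -/
lemma IsLocalFlatFolding.not_crease_line {φ : Plane → Plane} (hφ : IsLocalFlatFolding φ)
    {z d : Plane} (hd0 : d ≠ 0) (h : ∀ s : ℝ, IsCreasePoint φ (z + s • d)) : False := by
  have hdir : ∀ s : ℝ, IsCreaseDirection φ (z + s • d) d := by
    intro s
    refine (h s).isCreaseDirection hφ (Filter.Eventually.of_forall fun u => ?_).frequently hd0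
    rw [add_assoc, ← add_smul]
    exact h _
  choose D hD hloc using fun s => (hdir s).2.2
  refine hφ.not_isometric_line hd0 (hD 0) (z := z) fun s => ?_
  have := exists_eq_add_smul_of_locally (h := fun s => φ (z + s • d)) (D := D)
    (fun s => (hloc s).mono fun u hu => by rwa [add_assoc, ← add_smul] at hu) s
  simpa using this

/-! ### Creases end at vertex points. -/

lemma forall_openSegment_iff {P : Plane → Prop} (p d : Plane) (α β : ℝ) :
    (∀ x ∈ openSegment ℝ (p + α • d) (p + β • d), P x) ↔
      ∀ γ ∈ openSegment ℝ α β, P (p + γ • d) := by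
  let A : ℝ →ᵃ[ℝ] Plane := AffineMap.lineMap p (p + d)
  have hA : ∀ t : ℝ, A t = p + t • d := fun t => by
    simp [A, AffineMap.lineMap_apply, add_comm]
  rw [← hA, ← hA, ← image_openSegment, Set.forall_mem_image]
  simp only [hA]

/-- A crease extends along its line up to a vertex point or to infinity. -/
lemma IsCreaseDirection.ray_or_exists_vertex {φ : Plane → Plane} (hφ : IsLocalFlatFolding φ)
    {p d : Plane} (hd : IsCreaseDirection φ p d) (hd0 : d ≠ 0) :
    (∀ s : ℝ, 0 ≤ s → IsCreasePoint φ (p + s • d)) ∨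
      ∃ T : ℝ, 0 < T ∧ IsVertexPoint φ (p + T • d) ∧
        ∀ s : ℝ, 0 ≤ s → s < T → IsCreasePoint φ (p + s • d) := by
  by_cases hray : ∀ s : ℝ, 0 ≤ s → IsCreasePoint φ (p + s • d)
  · exact Or.inl hray
  right
  push Not at hray
  set A : Set ℝ := {s | 0 ≤ s ∧ ¬ IsCreasePoint φ (p + s • d)} with hA
  have hAne : A.Nonempty := hray
  have hAbd : BddBelow A := ⟨0, fun s hs => hs.1⟩
  have hlt : ∀ s : ℝ, 0 ≤ s → s < sInf A → IsCreasePoint φ (p + s • d) := by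
    intro s hs hsA
    by_contra h
    exact (csInf_le hAbd ⟨hs, h⟩).not_gt hsA
  obtain ⟨ε, hε, hloc⟩ := Metric.eventually_nhds_iff.1 hd.2.1
  have hT : 0 < sInf A := by
    refine hε.trans_le (le_csInf hAne fun s hs => ?_)
    by_contra hlt
    exact hs.2 (hloc (by rw [Real.dist_eq, sub_zero, abs_of_nonneg hs.1]; exact not_le.1 hlt))
  have hleft : ∀ᶠ s in 𝓝[<] (0 : ℝ), IsCreasePoint φ (p + sInf A • d + s • d) := by
    filter_upwards [Ioo_mem_nhdsLT (neg_lt_zero.2 hT)] with s hs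
    rw [add_assoc, ← add_smul]
    exact hlt _ (by linarith [hs.1]) (by linarith [hs.2])
  have hU : ¬ IsUnfoldedPoint φ (p + sInf A • d) := by
    refine (isOpen_setOf_isUnfoldedPoint φ).isClosed_compl.mem_of_tendsto
      ((tendsto_add_smul (p + sInf A • d) d).mono_left nhdsWithin_le_nhds :
        Filter.Tendsto _ (𝓝[<] (0 : ℝ)) _) (hleft.mono fun s hs => hs.1)
  refine ⟨sInf A, hT, ?_, hlt⟩
  -- The first point that is not a crease point is folded, as a limit of folded points. Were it a
  -- crease point, the crease would continue beyond the infimum.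
  by_contra hV
  have hC := hφ.isCreasePoint_of hU hV
  have hdir := hC.isCreaseDirection hφ (d := d)
    (hleft.frequently.filter_mono (nhdsWithin_mono _ fun s (hs : s < 0) => hs.ne)) hd0
  obtain ⟨δ, hδ, hloc'⟩ := Metric.eventually_nhds_iff.1 hdir.2.1
  obtain ⟨s, hs, hsd⟩ := exists_lt_of_csInf_lt hAne (lt_add_of_pos_right (sInf A) hδ)
  have hsA := csInf_le hAbd hs
  refine hs.2 ?_
  have := hloc' (y := s - sInf A) (by
    rw [Real.dist_eq, sub_zero, abs_of_nonneg (by linarith)]; linarith)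
  rwa [add_assoc, ← add_smul, add_sub_cancel] at this

/-- The vertex point `v` is `k`, or an end of the crease that contains the crease point `k`. -/
def IsAttached (φ : Plane → Plane) (v k : Plane) : Prop :=
  IsVertexPoint φ v ∧ (v = k ∨ IsCreasePoint φ k ∧ ∀ x ∈ openSegment ℝ v k, IsCreasePoint φ x)

lemma IsAttached.not_isUnfoldedPoint {φ : Plane → Plane} {v k : Plane} (h : IsAttached φ v k) :
    ¬ IsUnfoldedPoint φ k := by
  obtain ⟨hv, rfl | hk⟩ := h
  exacts [hv.1, hk.1.1]

/-- Every folded point is attached to a vertex point. -/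
lemma IsLocalFlatFolding.exists_isAttached {φ : Plane → Plane} (hφ : IsLocalFlatFolding φ)
    {k : Plane} (hk : ¬ IsUnfoldedPoint φ k) : ∃ v, IsAttached φ v k := by
  rcases (hφ.point_type k).resolve_left hk with hC | hV
  · obtain ⟨d, hd0, hd⟩ := hC.exists_isCreaseDirection hφ
    have key : ∀ e : Plane, (∃ T : ℝ, 0 < T ∧ IsVertexPoint φ (k + T • e) ∧
        ∀ s : ℝ, 0 ≤ s → s < T → IsCreasePoint φ (k + s • e)) → ∃ v, IsAttached φ v k := by
      rintro e ⟨T, hT, hv, h⟩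
      refine ⟨_, hv, Or.inr ⟨hC, ?_⟩⟩
      have := (forall_openSegment_iff (P := IsCreasePoint φ) k e T 0).2 fun γ hγ => by
        rw [openSegment_symm, openSegment_eq_Ioo hT] at hγ
        exact h γ hγ.1.le hγ.2
      simpa using this
    have hd' := hd.smul (c := -1) (by norm_num)
    rw [neg_one_smul] at hd'
    rcases hd.ray_or_exists_vertex hφ hd0 with h1 | h1
    · rcases hd'.ray_or_exists_vertex hφ (neg_ne_zero.2 hd0) with h2 | h2
      · refine (hφ.not_crease_line hd0 (z := k) fun s => ?_).elim
        rcases le_total 0 s with hs | hs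
        · exact h1 s hs
        · simpa using h2 (-s) (neg_nonneg.2 hs)
      · exact key _ h2
    · exact key _ h1
  · exact ⟨k, hV, Or.inl rfl⟩

/-- A vertex point attached to a crease point lies on the line of the crease. -/
lemma IsAttached.exists_eq_add_smul {φ : Plane → Plane} {v k d : Plane} (h : IsAttached φ v k)
    (hk : IsCreasePoint φ k) (hd : IsCreaseDirection φ k d) :
    ∃ α : ℝ, α ≠ 0 ∧ v = k + α • d ∧ ∀ γ ∈ openSegment ℝ α 0, IsCreasePoint φ (k + γ • d) := by
  obtain ⟨hv, rfl | ⟨-, hseg⟩⟩ := h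
  · exact absurd hk hv.2.1
  have hvk : v ≠ k := fun h => hv.2.1 (h ▸ hk)
  have hseg' : ∀ γ ∈ openSegment ℝ (1 : ℝ) 0, IsCreasePoint φ (k + γ • (v - k)) := by
    rw [← forall_openSegment_iff]
    simpa using hseg
  -- A point of the segment close enough to `k` is folded, hence on the crease line, so `v - k` is
  -- parallel to `d`.
  obtain ⟨t, h1, ht⟩ := ((((tendsto_add_smul k (v - k)).eventually hd.1).filter_mono
    (nhdsWithin_le_nhds (s := Set.Ioi (0 : ℝ)))).and (Ioo_mem_nhdsGT one_pos)).exists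
  obtain ⟨s, hs⟩ := h1 (hseg' t (by rwa [openSegment_symm, openSegment_eq_Ioo one_pos])).1
  have hvd : v - k = (s / t) • d := by
    rw [div_eq_inv_mul, mul_smul, ← add_left_cancel hs, inv_smul_smul₀ ht.1.ne']
  have hα : v = k + (s / t) • d := by rw [← hvd]; abel
  refine ⟨s / t, ?_, hα, ?_⟩
  · rintro h0
    rw [h0, zero_smul, sub_eq_zero] at hvd
    exact hvk hvd
  · rw [← forall_openSegment_iff, ← hα]
    simpa using hseg

/-- Two vertex points attached to the same point are equal or joined by an edge. -/
lemma IsAttached.eq_or_isSegmentEdge {φ : Plane → Plane} (hφ : IsLocalFlatFolding φ)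
    {v w k : Plane} (hv : IsAttached φ v k) (hw : IsAttached φ w k) :
    v = w ∨ IsSegmentEdge φ v w := by
  by_cases hk : IsCreasePoint φ k
  swap
  · left
    rw [hv.2.resolve_right fun h => hk h.1, hw.2.resolve_right fun h => hk h.1]
  by_cases hvw : v = w
  · exact Or.inl hvw
  refine Or.inr ⟨hv.1, hw.1, hvw, ?_⟩
  obtain ⟨d, -, hd⟩ := hk.exists_isCreaseDirection hφ
  obtain ⟨α, hα, rfl, h1⟩ := hv.exists_eq_add_smul hk hd
  obtain ⟨β, hβ, rfl, h2⟩ := hw.exists_eq_add_smul hk hd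
  have hαβ : α ≠ β := by rintro rfl; exact hvw rfl
  -- Neither vertex point lies between `k` and the other, so `α` and `β` have opposite signs and the
  -- two half-creases join at `k`.
  have h1' : α ∉ openSegment ℝ β 0 := fun h => hv.1.2.1 (h2 α h)
  have h2' : β ∉ openSegment ℝ α 0 := fun h => hw.1.2.1 (h1 β h)
  rw [forall_openSegment_iff]
  rw [openSegment_eq_Ioo' hα] at h1 h2'
  rw [openSegment_eq_Ioo' hβ] at h2 h1'
  rw [openSegment_eq_Ioo' hαβ]
  intro γ hγ
  rcases eq_or_ne γ 0 with rfl | hγ0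
  · simpa using hk
  by_cases hγα : γ ∈ Set.Ioo (min α 0) (max α 0)
  · exact h1 γ hγα
  refine h2 γ ?_
  simp only [Set.mem_Ioo] at *
  grind

/-- Folded points near `k` are attached to the vertex points to which `k` is attached. -/
lemma IsAttached.eventually {φ : Plane → Plane} (hφ : IsLocalFlatFolding φ) {v k : Plane}
    (h : IsAttached φ v k) : ∀ᶠ x in 𝓝 k, ¬ IsUnfoldedPoint φ x → IsAttached φ v x := by
  by_cases hk : IsCreasePoint φ k
  swap
  · obtain rfl := h.2.resolve_right fun h => hk h.1
    filter_upwards [hφ.eventually_isCreasePoint v] with x hx hU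
    rcases eq_or_ne x v with rfl | hne
    · exact h
    · exact ⟨h.1, Or.inr (hx hU hne)⟩
  obtain ⟨d, hd0, hd⟩ := hk.exists_isCreaseDirection hφ
  obtain ⟨α, hα, rfl, h1⟩ := h.exists_eq_add_smul hk hd
  obtain ⟨ε, hε, hloc⟩ := Metric.eventually_nhds_iff.1 hd.2.1
  have hdn : 0 < ‖d‖ := norm_pos_iff.2 hd0
  -- The bound `ε` keeps `x` on the crease, and `|α|` keeps it from reaching or passing the vertex
  -- point.
  filter_upwards [hd.1, Metric.ball_mem_nhds k (mul_pos (lt_min hε (abs_pos.2 hα)) hdn)]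
    with x hx hxb hU
  obtain ⟨s, rfl⟩ := hx hU
  rw [mem_ball_iff_norm, add_sub_cancel_left, norm_smul, mul_lt_mul_iff_left₀ hdn,
    Real.norm_eq_abs, lt_min_iff] at hxb
  have hloc' : ∀ t : ℝ, |t| < ε → IsCreasePoint φ (k + t • d) := fun t ht =>
    hloc (by rwa [Real.dist_eq, sub_zero])
  refine ⟨h.1, Or.inr ⟨hloc' s hxb.1, ?_⟩⟩
  rw [forall_openSegment_iff]
  have hsα : α ≠ s := by rintro rfl; exact lt_irrefl _ hxb.2
  rw [openSegment_eq_Ioo' hα] at h1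
  rw [openSegment_eq_Ioo' hsα]
  intro γ hγ
  by_cases hγα : γ ∈ Set.Ioo (min α 0) (max α 0)
  · exact h1 γ hγα
  refine hloc' γ ?_
  simp only [Set.mem_Ioo] at *
  grind

/-! ### Connected frontiers of faces. -/

/-- A convex set in the plane that contains no line has a connected frontier: any two frontier
points whose midpoint is interior lie on a path in the frontier. -/
lemma exists_preconnected_subset_frontier {E : Set Plane} (hE : Convex ℝ E) {m a : Plane}
    (hm : m ∈ interior E) (ha : m + a ∈ frontier E) (ha' : m - a ∈ frontier E)
    (hline : ∀ d : Plane, d ≠ 0 → ∃ s : ℝ, m + s • d ∉ E) :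
    ∃ P ⊆ frontier E, IsPreconnected P ∧ m + a ∈ P ∧ m - a ∈ P := by
  set C : Set Plane := (fun v => m + v) ⁻¹' E with hC
  have hCc : Convex ℝ C := hE.translate_preimage_right m
  have hC0 : C ∈ 𝓝 (0 : Plane) := by
    have : Continuous fun v : Plane => m + v := by fun_prop
    refine this.continuousAt ?_
    simpa using mem_interior_iff_mem_nhds.1 hm
  have hfr : ∀ v, v ∈ frontier C ↔ m + v ∈ frontier E := by
    intro v
    have := (Homeomorph.addLeft m).preimage_frontier E
    rw [show C = (Homeomorph.addLeft m) ⁻¹' E from rfl, ← this]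
    rfl
  have hone : ∀ v, gauge C v = 1 ↔ m + v ∈ frontier E := fun v => by
    rw [gauge_eq_one_iff_mem_frontier hCc hC0, hfr]
  have hga : gauge C a = 1 := (hone a).2 ha
  have hga' : gauge C (-a) = 1 := (hone _).2 (by rwa [← sub_eq_add_neg])
  have hcont : Continuous (gauge C) := continuous_gauge hCc hC0
  have habs : Absorbent ℝ C := absorbent_nhds_zero hC0
  have hm' : m ∉ frontier E := fun h => h.2 hm
  have ha0 : a ≠ 0 := by rintro rfl; exact hm' (by simpa using ha)
  have hmul : ∀ (t : ℝ) (v : Plane), 0 ≤ t → gauge C (t • v) = t * gauge C v := fun t v ht => by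
    rw [gauge_smul_of_nonneg ht, smul_eq_mul]
  -- The path runs from `-a` through `σ • perp a` to `a`; where the gauge does not vanish, dividing
  -- by it projects the path radially to the frontier.
  by_cases h : ∃ σ : ℝ, (σ = 1 ∨ σ = -1) ∧ ∀ t ∈ Set.Icc (-1 : ℝ) 1,
      gauge C (t • a + (σ * (1 - |t|)) • perp a) ≠ 0
  · obtain ⟨σ, -, hσ⟩ := h
    set w : ℝ → Plane := fun t => t • a + (σ * (1 - |t|)) • perp a with hw
    have hwc : Continuous w := by fun_prop
    refine ⟨(fun t => m + (gauge C (w t))⁻¹ • w t) '' Set.Icc (-1) 1, ?_, ?_, ?_, ?_⟩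
    · rintro _ ⟨t, ht, rfl⟩
      rw [← hone, hmul _ _ (inv_nonneg.2 (gauge_nonneg _)), inv_mul_cancel₀ (hσ t ht)]
    · refine isPreconnected_Icc.image _ (continuousOn_const.add ?_)
      exact ((hcont.comp hwc).continuousOn.inv₀ hσ).smul hwc.continuousOn
    · exact ⟨1, by norm_num, by simp [w, hga]⟩
    · exact ⟨-1, by norm_num, by simp [w, hga', sub_eq_add_neg]⟩
  -- Otherwise the gauge vanishes at some `v` and `v'` on opposite sides of the line of `a`. A
  -- positive combination is a multiple of `a` with gauge zero, hence zero, so `v'` points opposite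
  -- to `v` and `C` contains the line of `v`.
  · push Not at h
    obtain ⟨t, ht, h1⟩ := h 1 (Or.inl rfl)
    obtain ⟨u, hu, h2⟩ := h (-1) (Or.inr rfl)
    rw [one_mul] at h1
    have hlt : ∀ (c t : ℝ), t ∈ Set.Icc (-1 : ℝ) 1 →
        gauge C (t • a + (c * (1 - |t|)) • perp a) = 0 → 0 < 1 - |t| := by
      intro c t ht h
      rcases (abs_le.2 ht).lt_or_eq with h' | h'
      · linarith
      · rw [h', sub_self, mul_zero, zero_smul, add_zero] at h
        rcases (abs_eq zero_le_one).1 h' with rfl | rfl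
        · rw [one_smul, hga] at h; norm_num at h
        · rw [neg_one_smul, hga'] at h; norm_num at h
    have ht1 := hlt 1 t ht (by rwa [one_mul])
    have hu1 := hlt (-1) u hu h2
    set v := t • a + (1 - |t|) • perp a with hv
    set v' := u • a + (-1 * (1 - |u|)) • perp a with hv'
    set c := (1 - |u|) * t + (1 - |t|) * u with hc
    have hsum : (1 - |u|) • v + (1 - |t|) • v' = c • a := by
      rw [hv, hv', hc]; module
    have hg0 : gauge C (c • a) = 0 := by
      refine le_antisymm ?_ (gauge_nonneg _)
      rw [← hsum]
      refine (gauge_add_le hCc habs _ _).trans ?_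
      rw [hmul _ _ hu1.le, hmul _ _ ht1.le, h1, h2, mul_zero, mul_zero, add_zero]
    have hc0 : c = 0 := by
      rcases le_total 0 c with h | h
      · rwa [hmul _ _ h, hga, mul_one] at hg0
      · rw [← neg_neg c, neg_smul, ← smul_neg, hmul _ _ (neg_nonneg.2 h), hga', mul_one] at hg0
        linarith
    have hvne : v ≠ 0 := by
      intro h0
      have h3 : inner ℝ (perp a) v = (1 - |t|) * ‖a‖ ^ 2 := by
        rw [hv, inner_add_right, real_inner_smul_right, real_inner_smul_right,
          real_inner_self_eq_norm_sq, norm_perp, real_inner_comm, inner_perp, mul_zero, zero_add]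
      rw [h0, inner_zero_right] at h3
      have := mul_pos ht1 (pow_pos (norm_pos_iff.2 ha0) 2)
      linarith
    have hneg : gauge C (-v) = 0 := by
      rw [hc0, zero_smul, add_eq_zero_iff_neg_eq] at hsum
      have h3 : (1 - |u|) * gauge C (-v) = 0 := by
        rw [← hmul _ _ hu1.le, smul_neg, hsum, hmul _ _ ht1.le, h2, mul_zero]
      exact (mul_eq_zero.1 h3).resolve_left hu1.ne'
    obtain ⟨s, hs⟩ := hline v hvne
    refine absurd ?_ hs
    have h4 : gauge C (s • v) = 0 := by
      rcases le_total 0 s with h | h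
      · rw [hmul _ _ h, h1, mul_zero]
      · rw [← neg_neg s, neg_smul, ← smul_neg, hmul _ _ (neg_nonneg.2 h), hneg, mul_zero]
    have h5 : s • v ∈ interior C :=
      (gauge_lt_one_iff_mem_interior hCc hC0).1 (by rw [h4]; exact one_pos)
    have h6 : s • v ∈ C := interior_subset h5
    exact h6

/-- A preconnected set of unfolded points is mapped by a single isometry. -/
lemma exists_isometryEquiv_of_isPreconnected {φ : Plane → Plane} {s : Set Plane}
    (hs : IsPreconnected s) (hne : s.Nonempty) (hU : ∀ x ∈ s, IsUnfoldedPoint φ x) :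
    ∃ f : Plane ≃ᵢ Plane, s ⊆ interior {x | φ x = f x} := by
  obtain ⟨m, hm⟩ := hne
  obtain ⟨f, hf⟩ := (hU m hm).exists_isometryEquiv
  refine ⟨f, hs.subset_left_of_subset_union isOpen_interior
    (v := ⋃ g ∈ {g : Plane ≃ᵢ Plane | g ≠ f}, interior {x | φ x = g x})
    (isOpen_biUnion fun _ _ => isOpen_interior) ?_ ?_ ⟨m, hm, mem_interior_agree_iff.2 hf⟩⟩
  · rw [Set.disjoint_left]
    intro x hx hx'
    simp only [Set.mem_iUnion] at hx'
    obtain ⟨g, hg, hxg⟩ := hx'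
    rw [mem_interior_agree_iff] at hx hxg
    exact hg (isometryEquiv_ext_of_eventually (hx.mp (hxg.mono fun y h1 h2 => h1.symm.trans h2)))
  · intro x hx
    obtain ⟨g, hg⟩ := (hU x hx).exists_isometryEquiv
    by_cases hgf : g = f
    · subst hgf
      exact Or.inl (mem_interior_agree_iff.2 hg)
    · exact Or.inr (Set.mem_biUnion hgf (mem_interior_agree_iff.2 hg))

/-- Two folded points with only unfolded points strictly between them lie in a preconnected set
of folded points. -/
lemma IsLocalFlatFolding.exists_preconnected_folded {φ : Plane → Plane}
    (hφ : IsLocalFlatFolding φ) {x y : Plane} (hx : ¬ IsUnfoldedPoint φ x)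
    (hy : ¬ IsUnfoldedPoint φ y) (h : ∀ z ∈ openSegment ℝ x y, IsUnfoldedPoint φ z) :
    ∃ P : Set Plane, IsPreconnected P ∧ x ∈ P ∧ y ∈ P ∧ ∀ z ∈ P, ¬ IsUnfoldedPoint φ z := by
  obtain ⟨f, hf⟩ := exists_isometryEquiv_of_isPreconnected (convex_openSegment x y).isPreconnected
    ⟨_, midpoint_mem_openSegment x y⟩ h
  set E := {x | φ x = f x} with hE
  have hcl : IsClosed E := isClosed_agree hφ.continuous f
  have hsub : segment ℝ x y ⊆ E := by
    rw [← closure_openSegment]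
    exact closure_minimal (hf.trans interior_subset) hcl
  have hfr : ∀ z ∈ E, ¬ IsUnfoldedPoint φ z → z ∈ frontier E := fun z hz hU => by
    rw [hcl.frontier_eq]
    exact ⟨hz, fun hi => hU (isUnfoldedPoint_of_eventually_eq f (mem_interior_agree_iff.1 hi))⟩
  set m := midpoint ℝ x y with hm
  have hmE : m ∈ interior E := hf (midpoint_mem_openSegment x y)
  have hxm : m + (x - m) = x := by abel
  have hym : m - (x - m) = y := by
    rw [hm, midpoint_eq_smul_add, invOf_eq_inv]; module
  obtain ⟨P, hP, hPc, h1, h2⟩ := exists_preconnected_subset_frontier (hφ.convex_agree f) hmE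
    (a := x - m) (by rw [hxm]; exact hfr x (hsub (left_mem_segment _ _ _)) hx)
    (by rw [hym]; exact hfr y (hsub (right_mem_segment _ _ _)) hy) (by
      intro d hd
      by_contra hline
      push Not at hline
      obtain ⟨L, hL⟩ := exists_linearIsometryEquiv f
      refine hφ.not_isometric_line hd (L.norm_map d) (z := m) fun s => ?_
      have h0 : m ∈ E := interior_subset hmE
      replace h0 : φ m = f m := h0
      have hs : φ (m + s • d) = f (m + s • d) := hline s
      rw [hs, h0, hL, map_smul])
  rw [hxm] at h1
  rw [hym] at h2
  refine ⟨P, hPc, h1, h2, fun z hz hU => ?_⟩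
  obtain ⟨g, hg⟩ := hU.exists_isometryEquiv
  have hzfr := hP hz
  -- An isometry valid near `z` meets the interior of `E` and therefore equals `f`, which would make
  -- `z` interior.
  have hzcl : z ∈ closure (interior E) := by
    rw [(hφ.convex_agree f).closure_interior_eq_closure_of_nonempty_interior ⟨m, hmE⟩]
    exact hzfr.1
  obtain ⟨q, hq, hqi⟩ := mem_closure_iff_nhds.1 hzcl _ (Filter.Eventually.eventually_nhds hg)
  have hgf : g = f := isometryEquiv_ext_of_eventually
    ((mem_interior_agree_iff.1 hqi).mp (Filter.Eventually.mono hq fun y h1 h2 => h1.symm.trans h2))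
  rw [hgf] at hg
  exact hzfr.2 (mem_interior_agree_iff.2 hg)

/-! ### Connectedness of the folded points and of the graph. -/

/-- If two classes of folded points are relatively open and cover the folded points, one of them
is empty. -/
lemma IsLocalFlatFolding.not_separated {φ : Plane → Plane} (hφ : IsLocalFlatFolding φ)
    {X Y : Set Plane} (hXU : ∀ x ∈ X, ¬ IsUnfoldedPoint φ x) (hYU : ∀ x ∈ Y, ¬ IsUnfoldedPoint φ x)
    (hX : ∀ x ∈ X, ∀ᶠ y in 𝓝 x, ¬ IsUnfoldedPoint φ y → y ∈ X)
    (hY : ∀ x ∈ Y, ∀ᶠ y in 𝓝 x, ¬ IsUnfoldedPoint φ y → y ∈ Y)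
    (hXY : Disjoint X Y) (hcov : ∀ x, ¬ IsUnfoldedPoint φ x → x ∈ X ∪ Y)
    (hXne : X.Nonempty) (hYne : Y.Nonempty) : False := by
  have hclosed : ∀ {X Y : Set Plane}, (∀ x ∈ X, ¬ IsUnfoldedPoint φ x) →
      (∀ x ∈ Y, ∀ᶠ y in 𝓝 x, ¬ IsUnfoldedPoint φ y → y ∈ Y) → Disjoint X Y →
      (∀ x, ¬ IsUnfoldedPoint φ x → x ∈ X ∪ Y) → IsClosed X := by
    intro X Y hXU hY hXY hcov
    rw [← isOpen_compl_iff, isOpen_iff_mem_nhds]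
    intro x hx
    by_cases hU : IsUnfoldedPoint φ x
    · filter_upwards [(isOpen_setOf_isUnfoldedPoint φ).mem_nhds hU] with y hy hyX
      exact hXU y hyX hy
    · filter_upwards [hY x ((hcov x hU).resolve_left hx)] with y hy hyX
      exact Set.disjoint_left.1 hXY hyX (hy (hXU y hyX))
  have hXc := hclosed hXU hY hXY hcov
  have hYc := hclosed hYU hX hXY.symm (fun x hx => (hcov x hx).symm)
  obtain ⟨u, hu⟩ := hXne
  obtain ⟨w, hw⟩ := hYne
  have hseg : IsCompact (segment ℝ u w) := by
    rw [segment_eq_image_lineMap]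
    exact isCompact_Icc.image AffineMap.lineMap_continuous
  have hne : ((X ∩ segment ℝ u w) ×ˢ (Y ∩ segment ℝ u w)).Nonempty :=
    ⟨(u, w), ⟨hu, left_mem_segment _ _ _⟩, hw, right_mem_segment _ _ _⟩
  -- A folded point strictly between `x` and `y` would belong to one class and be closer to the
  -- other, so a closest pair has none.
  obtain ⟨⟨x, y⟩, ⟨⟨hxX, hxs⟩, hyY, hys⟩, hmin⟩ :=
    ((hseg.inter_left hXc).prod (hseg.inter_left hYc)).exists_isMinOn hne
      continuous_dist.continuousOn
  have hmin' : ∀ x' ∈ X ∩ segment ℝ u w, ∀ y' ∈ Y ∩ segment ℝ u w, dist x y ≤ dist x' y' :=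
    fun x' hx' y' hy' => isMinOn_iff.1 hmin (x', y') ⟨hx', hy'⟩
  have hxy : x ≠ y := fun h => Set.disjoint_left.1 hXY hxX (h ▸ hyY)
  have hd : 0 < dist x y := dist_pos.2 hxy
  obtain ⟨P, hPc, hxP, hyP, hPU⟩ := hφ.exists_preconnected_folded (hXU x hxX) (hYU y hyY) (by
    intro z hz
    by_contra hU
    have hzs : z ∈ segment ℝ u w := (convex_segment u w).segment_subset hxs hys
      (openSegment_subset_segment _ _ _ hz)
    rw [openSegment_eq_image_lineMap] at hz
    obtain ⟨t, ⟨ht0, ht1⟩, rfl⟩ := hz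
    rcases hcov _ hU with h | h
    · have := hmin' _ ⟨h, hzs⟩ y ⟨hyY, hys⟩
      rw [dist_lineMap_right, Real.norm_of_nonneg (by linarith)] at this
      have := mul_pos ht0 hd
      linarith
    · have := hmin' x ⟨hxX, hxs⟩ _ ⟨h, hzs⟩
      rw [dist_left_lineMap, Real.norm_of_nonneg ht0.le] at this
      have := mul_pos (sub_pos.2 ht1) hd
      linarith)
  obtain ⟨z, hzP, hzX, hzY⟩ := isPreconnected_closed_iff.1 hPc X Y hXc hYc
    (fun z hz => hcov z (hPU z hz)) ⟨x, hxP, hxX⟩ ⟨y, hyP, hyY⟩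
  exact Set.disjoint_left.1 hXY hzX hzY

lemma IsSegmentEdge.adj_deleteVerts {φ : Plane → Plane} {p q : Plane} (h : IsSegmentEdge φ p q) :
    ((foldingGraph φ).deleteVerts {none}).Adj (some p) (some q) :=
  ⟨Sum.inl s(p, q), by
    rw [Graph.deleteVerts_isLink]
    exact ⟨FoldingLink.segment p q h, by simp, by simp⟩⟩

/-- Folded points are classified by whether an attached vertex point is reachable from `u`. Vertex
points attached to the same point are equal or adjacent, so the classes are disjoint;
`IsAttached.eventually` makes them relatively open. -/
lemma IsLocalFlatFolding.isConnected_deleteVerts {φ : Plane → Plane}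
    (hφ : IsLocalFlatFolding φ) : IsConnected ((foldingGraph φ).deleteVerts {none}) := by
  have hvert : ∀ x ∈ ((foldingGraph φ).deleteVerts {none}).vertexSet,
      ∃ p, x = some p ∧ IsVertexPoint φ p := by
    intro x hx
    rw [Graph.vertexSet_deleteVerts] at hx
    exact hx.1.resolve_right fun h => hx.2 h.1
  intro u hu w hw
  obtain ⟨u, rfl, huV⟩ := hvert u hu
  obtain ⟨w, rfl, hwV⟩ := hvert w hw
  by_contra hnot
  let R := Relation.ReflTransGen ((foldingGraph φ).deleteVerts {none}).Adj
  have hstep : ∀ {v v' k : Plane}, IsAttached φ v k → IsAttached φ v' k →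
      R (some u) (some v) → R (some u) (some v') := by
    intro v v' k hv hv' h
    rcases hv.eq_or_isSegmentEdge hφ hv' with rfl | he
    · exact h
    · exact h.tail he.adj_deleteVerts
  refine hφ.not_separated (X := {k | ∃ v, IsAttached φ v k ∧ R (some u) (some v)})
    (Y := {k | ∃ v, IsAttached φ v k ∧ ¬ R (some u) (some v)}) ?_ ?_ ?_ ?_ ?_ ?_ ?_ ?_
  · rintro k ⟨v, hv, -⟩
    exact hv.not_isUnfoldedPoint
  · rintro k ⟨v, hv, -⟩
    exact hv.not_isUnfoldedPoint
  · rintro k ⟨v, hv, h⟩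
    exact (hv.eventually hφ).mono fun y hy hU => ⟨v, hy hU, h⟩
  · rintro k ⟨v, hv, h⟩
    exact (hv.eventually hφ).mono fun y hy hU => ⟨v, hy hU, h⟩
  · rw [Set.disjoint_left]
    rintro k ⟨v, hv, h⟩ ⟨v', hv', h'⟩
    exact h' (hstep hv hv' h)
  · intro k hk
    obtain ⟨v, hv⟩ := hφ.exists_isAttached hk
    by_cases h : R (some u) (some v)
    · exact Or.inl ⟨v, hv, h⟩
    · exact Or.inr ⟨v, hv, h⟩
  · exact ⟨u, u, ⟨huV, Or.inl rfl⟩, .refl⟩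
  · exact ⟨w, w, ⟨hwV, Or.inl rfl⟩, hnot⟩

end FlatFolding

theorem mainTheorem8 (φ : FlatFolding.Plane → FlatFolding.Plane)
    (hφ : FlatFolding.IsLocalFlatFolding φ) :
    ¬ FlatFolding.IsArticulationVertex (FlatFolding.foldingGraph φ) none :=
  fun h => h.2 hφ.isConnected_deleteVerts
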